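/- Let $\mathbb C_+=\{z\in\mathbb C:\operatorname{Im}z>0\}$ and let $\overline{\mathbb R}=\mathbb R\sqcup\{\infty\}$ be the boundary circle of $\mathbb C_+$ in the Riemann sphere. For $s\in\mathbb R$ put $\phi_s(z)=\frac{1+sz}{s-z}$, and put $\phi_\infty(z)=z$. An endomatrix is a matrix $M=\begin{pmatrix}a&b\\c&d\end{pmatrix}\in GL(2,\mathbb C)$ such that $\phi_M(z)=\frac{az+b}{cz+d}$ maps $\mathbb C_+$ into $\mathbb C_+$; products of endomatrices are endomatrices. For every endomatrix $M$ there is exactly one finite positive Borel measure $\mu_M$ on $\overline{\mathbb R}$ (the representing measure of $\phi_M$) such that $$\phi_M(z)=\operatorname{Re}\phi_M(i)+\int_{\overline{\mathbb R}}\phi_s(z)\,\mu_M(ds)\qquad(z\in\mathbb C_+).$$ For $f\in C(\overline{\mathbb R})$ (continuous, complex-valued) write $\mu_M(f)=\int_{\overline{\mathbb R}} f\,d\mu_M$. For $s\in\mathbb R$ let ${}_sM=\frac{1}{\sqrt{1+s^2}}\begin{pmatrix}s&1\\-1&s\end{pmatrix}M$, and let ${}_\infty M=M$; these are again endomatrices.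 Then, for every endomatrix $M$, the formula $$(\Lambda_Mf)(s)=\mu_{{}_sM}(f)\qquad(f\in C(\overline{\mathbb R}),\ s\in\overline{\mathbb R})$$ defines a bounded linear operator $\Lambda_M$ on $C(\overline{\mathbb R})$, which is positive ($\Lambda_Mf\ge0$ whenever $f\ge0$), and $$\Lambda_{MN}=\Lambda_M\Lambda_N$$ for all endomatrices $M$ and $N$. -/

import Mathlib

open scoped UpperHalfPlane MatrixGroups ComplexOrder
open MeasureTheory

namespace MobiusEndo

/-- The boundary circle of the upper half plane, `ℝ ∪ {∞}`, with its compact topology. -/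
abbrev Boundary : Type := OnePoint ℝ

instance : MeasurableSpace Boundary := borel Boundary

instance : BorelSpace Boundary := ⟨rfl⟩

/-- The atomic endofunction `φ_s(z) = (1 + s z) / (s - z)`, with `φ_∞(z) = z`. -/
noncomputable def atomic : Boundary → ℂ → ℂ
  | none => fun z => z
  | some s => fun z => (1 + (s : ℂ) * z) / ((s : ℂ) - z)

/-- `lam` is a representing measure of the self-map `φ` of the upper half plane: it is a
finite positive Borel measure on `ℝ ∪ {∞}` with
`φ(z) = Re φ(i) + ∫ φ_s(z) lam(ds)` for all `z` in the upper half plane. -/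
def IsRepresentingMeasure (φ : ℍ → ℍ) (lam : Measure Boundary) : Prop :=
  IsFiniteMeasure lam ∧
    ∀ z : ℍ, (φ z : ℂ) = ((φ UpperHalfPlane.I).re : ℂ) + ∫ s, atomic s (z : ℂ) ∂lam

open Classical in
/-- The representing measure of `φ` (the value `0` is used when there is none). -/
noncomputable def representingMeasure (φ : ℍ → ℍ) : Measure Boundary :=
  if h : ∃ lam, IsRepresentingMeasure φ lam then h.choose else 0

/-- The value `(a z + b) / (c z + d)` of the linear fractional transformation at `z`
(meaningful when `c z + d ≠ 0`). -/
noncomputable def mobius (A : GL (Fin 2) ℂ) (z : ℂ) : ℂ :=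
  (A 0 0 * z + A 0 1) / (A 1 0 * z + A 1 1)

/-- `A` maps the upper half plane into itself; in particular no point of the upper half plane is
sent to `∞`. -/
def IsEndomatrix (A : GL (Fin 2) ℂ) : Prop :=
  ∀ z : ℂ, 0 < z.im → A 1 0 * z + A 1 1 ≠ 0 ∧ 0 < (mobius A z).im

theorem mobius_mul (A B : GL (Fin 2) ℂ) (z : ℂ) (hB : B 1 0 * z + B 1 1 ≠ 0) :
    (A * B) 1 0 * z + (A * B) 1 1
      = (A 1 0 * mobius B z + A 1 1) * (B 1 0 * z + B 1 1) ∧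
    mobius (A * B) z = mobius A (mobius B z) := by
  have e : ∀ i : Fin 2, (A * B) i 0 * z + (A * B) i 1
      = (A i 0 * mobius B z + A i 1) * (B 1 0 * z + B 1 1) := by
    intro i
    simp only [Units.val_mul, Matrix.mul_apply, Fin.sum_univ_two, mobius]
    field_simp
    ring
  refine ⟨e 1, ?_⟩
  rw [mobius, e 0, e 1, mul_div_mul_right _ _ hB]
  rfl

/-- The semigroup of endomatrices, a submonoid of `GL(2, ℂ)`. -/
def Endomatrices : Submonoid (GL (Fin 2) ℂ) where
  carrier := {A | IsEndomatrix A}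
  one_mem' := by
    intro z hz
    simpa [mobius] using hz
  mul_mem' := by
    intro A B hA hB z hz
    obtain ⟨h1, h2⟩ := hB z hz
    obtain ⟨h3, h4⟩ := hA _ h2
    obtain ⟨e1, e2⟩ := mobius_mul A B z h1
    exact ⟨by rw [e1]; exact mul_ne_zero h3 h1, by rw [e2]; exact h4⟩

/-- The endofunction `φ_M(z) = M.z` of the upper half plane given by an endomatrix `M`. -/
noncomputable def endoFun (M : Endomatrices) (z : ℍ) : ℍ :=
  ⟨mobius (M : GL (Fin 2) ℂ) (z : ℂ), (M.2 (z : ℂ) z.im_pos).2⟩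

/-- The matrix `(1 + s²)^(-1/2) • !![s, 1; -1, s]` for real `s`. -/
noncomputable def rotation (s : ℝ) : GL (Fin 2) ℂ :=
  Matrix.GeneralLinearGroup.mkOfDetNeZero
    ((((Real.sqrt (1 + s ^ 2))⁻¹ : ℝ) : ℂ) • !![(s : ℂ), 1; -1, (s : ℂ)]) (by
      have h : (0 : ℝ) < 1 + s ^ 2 := by positivity
      rw [Matrix.det_smul, Matrix.det_fin_two_of]
      refine mul_ne_zero (pow_ne_zero _ ?_) ?_
      · exact_mod_cast (inv_pos.mpr (Real.sqrt_pos.mpr h)).ne'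
      · have h2 : (s : ℂ) * s - 1 * -1 = ((1 + s ^ 2 : ℝ) : ℂ) := by
          push_cast
          ring
        rw [h2]
        exact_mod_cast h.ne')

theorem rotation_coe (s : ℝ) : (rotation s : Matrix (Fin 2) (Fin 2) ℂ) =
    (((Real.sqrt (1 + s ^ 2))⁻¹ : ℝ) : ℂ) • !![(s : ℂ), 1; -1, (s : ℂ)] := rfl

theorem isEndomatrix_rotation (s : ℝ) : IsEndomatrix (rotation s) := by
  intro z hz
  set k : ℂ := (((Real.sqrt (1 + s ^ 2))⁻¹ : ℝ) : ℂ) with hk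
  have h : (0 : ℝ) < 1 + s ^ 2 := by positivity
  have hk0 : k ≠ 0 := by
    rw [hk]
    exact_mod_cast (inv_pos.mpr (Real.sqrt_pos.mpr h)).ne'
  have hsz : (s : ℂ) - z ≠ 0 := by
    intro h0
    have := congrArg Complex.im h0
    simp at this
    exact hz.ne' this
  have e1 : rotation s 1 0 * z + rotation s 1 1 = k * ((s : ℂ) - z) := by
    rw [rotation_coe]
    simp only [Matrix.smul_apply, Matrix.of_apply, Matrix.cons_val', Matrix.cons_val_zero,
      Matrix.cons_val_one, Matrix.cons_val_fin_one, smul_eq_mul, hk]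
    ring
  have e0 : rotation s 0 0 * z + rotation s 0 1 = k * ((s : ℂ) * z + 1) := by
    rw [rotation_coe]
    simp only [Matrix.smul_apply, Matrix.of_apply, Matrix.cons_val', Matrix.cons_val_zero,
      Matrix.cons_val_one, Matrix.cons_val_fin_one, smul_eq_mul, hk]
    ring
  refine ⟨by rw [e1]; exact mul_ne_zero hk0 hsz, ?_⟩
  rw [mobius, e1, e0, mul_div_mul_left _ _ hk0, Complex.div_im, ← sub_div]
  refine div_pos ?_ (Complex.normSq_pos.mpr hsz)
  simp
  nlinarith [mul_pos h hz]

/-- The endomatrix inducing the atomic endofunction `φ_s`; at `s = ∞` it is the identity. -/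
noncomputable def atomicMatrix : Boundary → Endomatrices
  | none => 1
  | some s => ⟨rotation s, isEndomatrix_rotation s⟩

/-- The left translate `ₛM`, that is `(1 + s²)^(-1/2) • !![s, 1; -1, s] * M` for real `s`, and
`M` for `s = ∞`. -/
noncomputable def leftTranslate (s : Boundary) (M : Endomatrices) : Endomatrices :=
  atomicMatrix s * M

/-- The representing measure `μ_M` of the endofunction `φ_M`. -/
noncomputable def mu (M : Endomatrices) : Measure Boundary :=
  representingMeasure (endoFun M)

end MobiusEndo

/-!
A finite measure on the boundary circle is known once its integrals of the functions `s ↦ φ_s(z)`,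
`z` in the upper half plane, are known: these functions are affine in the Cauchy kernels
`s ↦ (s - z)⁻¹`, and the resolvent identity makes the closed span of the Cauchy kernels, of their
conjugates and of the constants an algebra, so by Stone–Weierstrass they and their conjugates span
a dense subspace of `C(ℝ ∪ {∞})` (`dense_span_atomicFamily`). This gives the uniqueness of
representing measures.

Existence is explicit. If `φ_M` has its pole on the boundary circle, it is affine in an atomic
endofunction, and the measure is a multiple of the harmonic measure at `i` plus a point mass
(`exists_isRepresentingMeasure_of_affine_atomic`). Otherwise the pole lies in the open lower half
plane, and the measure has density `Im φ_M` with respect to the harmonic measure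
(`exists_isRepresentingMeasure_of_lower_pole`); the integrals that occur follow from the mean value
property on the disc, by the Cayley transform, and from partial fractions.

Since `φ_{ₛM} = φ_s ∘ φ_M`, the representation formula for `ₛM` says that `Λ_M` sends `s ↦ φ_s(z)`
to `s ↦ φ_s(φ_M(z)) - Re φ_s(φ_M(i))` (`boundaryOperator_atomicMap`). These images are continuous
in `s`, and the masses `Im φ_s(φ_M(i))` of the measures `μ_{ₛM}` are bounded in `s`, so by density
`Λ_M` maps continuous functions to continuous functions and is bounded. The operator `Λ_M` is given
by positive measures, so it is positive and commutes with conjugation and with real parts. Hence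
the multiplicativity of `Λ` may be checked on the functions `s ↦ φ_s(z)`, where the formula gives it
at once.
-/

namespace MobiusEndo

open Filter Topology

/-! ### Cauchy kernels on the boundary circle -/

theorem ofReal_sub_ne_zero {w : ℂ} (hw : w.im ≠ 0) (t : ℝ) : (t : ℂ) - w ≠ 0 := by
  intro h
  have := congrArg Complex.im h
  simp at this
  exact hw this

theorem tendsto_inv_ofReal_sub (w : ℂ) :
    Tendsto (fun t : ℝ => ((t : ℂ) - w)⁻¹) (cocompact ℝ) (𝓝 0) := by
  refine tendsto_inv₀_cobounded.comp ?_
  rw [Metric.cobounded_eq_cocompact]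
  have h1 : Tendsto (fun t : ℝ => (t : ℂ)) (cocompact ℝ) (cocompact ℂ) :=
    Complex.isometry_ofReal.isClosedEmbedding.tendsto_cocompact
  exact (Homeomorph.subRight w).isClosedEmbedding.tendsto_cocompact.comp h1

/-- The Cauchy kernel `s ↦ (s - w)⁻¹` at a non-real point `w`, extended by `0` at `∞`. -/
noncomputable def cauchyKernel (w : ℂ) (hw : w.im ≠ 0) : C(Boundary, ℂ) :=
  OnePoint.continuousMapMk
    ⟨fun t : ℝ => ((t : ℂ) - w)⁻¹,
      (Complex.continuous_ofReal.sub continuous_const).inv₀ (ofReal_sub_ne_zero hw)⟩ 0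
    (by rw [Filter.coclosedCompact_eq_cocompact]; exact tendsto_inv_ofReal_sub w)

@[simp]
theorem cauchyKernel_coe (w : ℂ) (hw : w.im ≠ 0) (t : ℝ) :
    cauchyKernel w hw (t : Boundary) = ((t : ℂ) - w)⁻¹ := rfl

@[simp]
theorem cauchyKernel_infty (w : ℂ) (hw : w.im ≠ 0) :
    cauchyKernel w hw OnePoint.infty = 0 := rfl

theorem star_cauchyKernel (w : ℂ) (hw : w.im ≠ 0) :
    star (cauchyKernel w hw) = cauchyKernel (star w) (by simpa using hw) := by
  ext s
  induction s using OnePoint.rec <;> simp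

/-- The resolvent identity for Cauchy kernels. -/
theorem cauchyKernel_sub (w v : ℂ) (hw : w.im ≠ 0) (hv : v.im ≠ 0) :
    cauchyKernel w hw - cauchyKernel v hv
      = (w - v) • (cauchyKernel w hw * cauchyKernel v hv) := by
  ext s
  induction s using OnePoint.rec with
  | infty => simp
  | coe t =>
    have h1 := ofReal_sub_ne_zero hw t
    have h2 := ofReal_sub_ne_zero hv t
    simp
    field_simp
    ring

theorem cauchyKernel_mul (w v : ℂ) (hw : w.im ≠ 0) (hv : v.im ≠ 0) (h : w ≠ v) :
    cauchyKernel w hw * cauchyKernel v hv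
      = (w - v)⁻¹ • (cauchyKernel w hw - cauchyKernel v hv) := by
  rw [cauchyKernel_sub, smul_smul, inv_mul_cancel₀ (sub_ne_zero.mpr h), one_smul]

theorem norm_cauchyKernel_le (w : ℂ) (hw : w.im ≠ 0) : ‖cauchyKernel w hw‖ ≤ |w.im|⁻¹ := by
  rw [ContinuousMap.norm_le _ (by positivity)]
  intro s
  induction s using OnePoint.rec with
  | infty => simp
  | coe t =>
    rw [cauchyKernel_coe, norm_inv]
    refine inv_anti₀ (abs_pos.mpr hw) ?_
    simpa using Complex.abs_im_le_norm ((t : ℂ) - w)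

/-- Every Cauchy kernel is the limit of the kernels at the real translates `w + r` of its pole,
`r ≠ 0`. -/
theorem tendsto_cauchyKernel_add_ofReal (w : ℂ) (hw : w.im ≠ 0) :
    Tendsto (fun r : ℝ => cauchyKernel (w + r) (by simpa using hw)) (𝓝[≠] 0)
      (𝓝 (cauchyKernel w hw)) := by
  refine Tendsto.mono_left ?_ nhdsWithin_le_nhds
  rw [tendsto_iff_norm_sub_tendsto_zero]
  have hlim : Tendsto (fun r : ℝ => |r| * (|w.im|⁻¹ * |w.im|⁻¹)) (𝓝 0) (𝓝 0) := by
    have : Continuous (fun r : ℝ => |r| * (|w.im|⁻¹ * |w.im|⁻¹)) := by fun_prop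
    simpa using this.tendsto 0
  refine squeeze_zero (fun _ => norm_nonneg _) (fun r => ?_) hlim
  rw [cauchyKernel_sub, norm_smul]
  have h1 : ‖w + (r : ℂ) - w‖ = |r| := by simp
  have h2 := norm_cauchyKernel_le (w + r) (by simpa using hw)
  simp only [Complex.add_im, Complex.ofReal_im, add_zero] at h2
  rw [h1]
  gcongr
  exact (norm_mul_le _ _).trans
    (mul_le_mul h2 (norm_cauchyKernel_le w hw) (norm_nonneg _) (by positivity))

/-! ### The atomic endofunctions as functions of the atom -/

theorem im_ne_zero (z : ℍ) : (z : ℂ).im ≠ 0 := z.im_pos.ne'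

/-- The function `s ↦ φ_s(z)` on the boundary circle, written through the Cauchy kernel
at `z`. -/
noncomputable def atomicMap (z : ℍ) : C(Boundary, ℂ) :=
  (z : ℂ) • (1 : C(Boundary, ℂ)) + (1 + (z : ℂ) ^ 2) • cauchyKernel z (im_ne_zero z)

theorem atomicMap_apply (z : ℍ) (s : Boundary) : atomicMap z s = atomic s z := by
  induction s using OnePoint.rec with
  | infty =>
    change _ = (z : ℂ)
    simp [atomicMap]
  | coe t =>
    change _ = (1 + (t : ℂ) * z) / ((t : ℂ) - z)
    have h1 := ofReal_sub_ne_zero (im_ne_zero z) t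
    simp [atomicMap]
    field_simp
    ring

theorem atomicMap_I : atomicMap UpperHalfPlane.I = Complex.I • (1 : C(Boundary, ℂ)) := by
  simp [atomicMap]

theorem star_atomicMap (z : ℍ) :
    star (atomicMap z) = (star (z : ℂ)) • (1 : C(Boundary, ℂ))
      + (1 + (star (z : ℂ)) ^ 2) • cauchyKernel (star (z : ℂ)) (by simpa using im_ne_zero z) := by
  rw [atomicMap, star_add, star_smul, star_smul, star_cauchyKernel]
  simp

/-! ### The atomic endofunctions span a dense subspace -/

/-- The functions `s ↦ φ_s(z)` and their complex conjugates. -/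
def atomicFamily : Set C(Boundary, ℂ) :=
  Set.range atomicMap ∪ Set.range (fun z => star (atomicMap z))

theorem one_mem_span_atomicFamily :
    (1 : C(Boundary, ℂ)) ∈ Submodule.span ℂ atomicFamily := by
  have h : atomicMap UpperHalfPlane.I ∈ Submodule.span ℂ atomicFamily :=
    Submodule.subset_span (Or.inl ⟨_, rfl⟩)
  have h2 := Submodule.smul_mem _ (-Complex.I) h
  rwa [atomicMap_I, smul_smul, neg_mul, Complex.I_mul_I, neg_neg, one_smul] at h2

theorem cauchyKernel_mem_span_atomicFamily (w : ℂ) (hw : w.im ≠ 0) (h : 1 + w ^ 2 ≠ 0) :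
    cauchyKernel w hw ∈ Submodule.span ℂ atomicFamily := by
  have key : w • (1 : C(Boundary, ℂ)) + (1 + w ^ 2) • cauchyKernel w hw
      ∈ Submodule.span ℂ atomicFamily := by
    rcases lt_or_gt_of_ne hw with h0 | h0
    · have h1 : star (atomicMap ⟨star w, by simpa using h0⟩) ∈ Submodule.span ℂ atomicFamily :=
        Submodule.subset_span (Or.inr ⟨_, rfl⟩)
      rw [star_atomicMap] at h1
      simpa using h1
    · exact Submodule.subset_span (Or.inl ⟨⟨w, h0⟩, rfl⟩)
  have h2 := Submodule.sub_mem _ key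
    (Submodule.smul_mem _ w one_mem_span_atomicFamily)
  have h3 := Submodule.smul_mem _ (1 + w ^ 2)⁻¹ h2
  rwa [add_sub_cancel_left, smul_smul, inv_mul_cancel₀ h, one_smul] at h3

theorem cauchyKernel_mem_closure (w : ℂ) (hw : w.im ≠ 0) :
    cauchyKernel w hw ∈ (Submodule.span ℂ atomicFamily).topologicalClosure := by
  refine (Submodule.isClosed_topologicalClosure _).mem_of_tendsto
    (tendsto_cauchyKernel_add_ofReal w hw) ?_
  -- Only the poles `±i` are exceptional, and they are isolated on every horizontal line.
  have hev : ∀ᶠ r : ℝ in 𝓝[≠] 0, 1 + (w + r) ^ 2 ≠ 0 := by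
    by_cases h : 1 + w ^ 2 = 0
    · have h1 : ∀ᶠ r : ℝ in 𝓝[≠] 0, r ≠ 0 := eventually_mem_nhdsWithin
      filter_upwards [h1] with r hr h2
      have h3 : (r : ℂ) * (2 * w + r) = 0 := by linear_combination h2 - h
      rcases mul_eq_zero.mp h3 with h4 | h4
      · exact hr (by exact_mod_cast h4)
      · have := congrArg Complex.im h4
        simp at this
        exact hw this
    · have hc : Continuous (fun r : ℝ => 1 + (w + (r : ℂ)) ^ 2) := by fun_prop
      refine Filter.Eventually.filter_mono nhdsWithin_le_nhds ?_
      exact hc.continuousAt.eventually_ne (by simpa using h)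
  filter_upwards [hev] with r hr
  exact Submodule.le_topologicalClosure _ (cauchyKernel_mem_span_atomicFamily _ _ hr)

theorem cauchyKernel_mul_mem_closure (w v : ℂ) (hw : w.im ≠ 0) (hv : v.im ≠ 0) :
    cauchyKernel w hw * cauchyKernel v hv
      ∈ (Submodule.span ℂ atomicFamily).topologicalClosure := by
  by_cases h : w = v
  · subst h
    have hlim := (tendsto_cauchyKernel_add_ofReal w hw).mul_const (cauchyKernel w hw)
    refine (Submodule.isClosed_topologicalClosure _).mem_of_tendsto hlim ?_
    have h1 : ∀ᶠ r : ℝ in 𝓝[≠] 0, r ≠ 0 := eventually_mem_nhdsWithin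
    filter_upwards [h1] with r hr
    rw [cauchyKernel_mul _ _ _ _ (by simpa using hr)]
    exact Submodule.smul_mem _ _
      (Submodule.sub_mem _ (cauchyKernel_mem_closure _ _) (cauchyKernel_mem_closure _ _))
  · rw [cauchyKernel_mul _ _ _ _ h]
    exact Submodule.smul_mem _ _
      (Submodule.sub_mem _ (cauchyKernel_mem_closure _ _) (cauchyKernel_mem_closure _ _))

theorem cauchyKernel_mul_mem_closure_of_mem (w : ℂ) (hw : w.im ≠ 0) {f : C(Boundary, ℂ)}
    (hf : f ∈ (Submodule.span ℂ atomicFamily).topologicalClosure) :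
    cauchyKernel w hw * f ∈ (Submodule.span ℂ atomicFamily).topologicalClosure := by
  set V := (Submodule.span ℂ atomicFamily).topologicalClosure with hV
  have hlin : ∀ (a b v : ℂ) (hv : v.im ≠ 0),
      cauchyKernel w hw * (a • (1 : C(Boundary, ℂ)) + b • cauchyKernel v hv) ∈ V := by
    intro a b v hv
    rw [mul_add, mul_smul_comm, mul_smul_comm, mul_one]
    exact V.add_mem (V.smul_mem _ (cauchyKernel_mem_closure w hw))
      (V.smul_mem _ (cauchyKernel_mul_mem_closure w v hw hv))
  have hspan : Submodule.span ℂ atomicFamily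
      ≤ V.comap (LinearMap.mulLeft ℂ (cauchyKernel w hw)) := by
    rw [Submodule.span_le]
    rintro _ (⟨z, rfl⟩ | ⟨z, rfl⟩)
    · exact hlin _ _ _ _
    · simp only [star_atomicMap]
      exact hlin _ _ _ _
  have hclosed : IsClosed {f : C(Boundary, ℂ) | cauchyKernel w hw * f ∈ V} :=
    (Submodule.isClosed_topologicalClosure _).preimage (continuous_const.mul continuous_id)
  exact closure_minimal hspan hclosed hf

/-- The closed span absorbs multiplication by Cauchy kernels, so it contains the star subalgebra
generated by the kernel at `i`, to which the Stone–Weierstrass theorem applies. -/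
theorem topologicalClosure_span_atomicFamily :
    (Submodule.span ℂ atomicFamily).topologicalClosure = ⊤ := by
  set V := (Submodule.span ℂ atomicFamily).topologicalClosure with hV
  have hI : Complex.I.im ≠ 0 := by simp
  set A : StarSubalgebra ℂ C(Boundary, ℂ) :=
    StarAlgebra.adjoin ℂ {cauchyKernel Complex.I hI} with hA
  have hmul : ∀ x ∈ A, ∀ v ∈ V, x * v ∈ V := by
    intro x hx
    induction hx using Algebra.adjoin_induction with
    | mem x hx =>
      intro v hv
      rcases hx with hx | hx
      · rw [Set.mem_singleton_iff] at hx
        subst hx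
        exact cauchyKernel_mul_mem_closure_of_mem _ _ hv
      · have hx' : x = star (cauchyKernel Complex.I hI) := by
          rw [← Set.mem_singleton_iff.mp hx, star_star]
        rw [hx', star_cauchyKernel]
        exact cauchyKernel_mul_mem_closure_of_mem _ _ hv
    | algebraMap r =>
      intro v hv
      rw [← Algebra.smul_def]
      exact V.smul_mem r hv
    | add x y _ _ h1 h2 =>
      intro v hv
      rw [add_mul]
      exact V.add_mem (h1 v hv) (h2 v hv)
    | mul x y _ _ h1 h2 =>
      intro v hv
      rw [mul_assoc]
      exact h1 _ (h2 v hv)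
  have hsub : (A : Set C(Boundary, ℂ)) ⊆ V := by
    intro x hx
    have := hmul x hx 1 (Submodule.le_topologicalClosure _ one_mem_span_atomicFamily)
    rwa [mul_one] at this
  have hsep : A.SeparatesPoints := by
    intro x y hxy
    refine ⟨cauchyKernel Complex.I hI, ⟨_, StarAlgebra.subset_adjoin ℂ _ rfl, rfl⟩, ?_⟩
    induction x using OnePoint.rec with
    | infty =>
      induction y using OnePoint.rec with
      | infty => exact absurd rfl hxy
      | coe t => simpa using (ofReal_sub_ne_zero hI t).symm
    | coe u =>
      induction y using OnePoint.rec with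
      | infty => simpa using ofReal_sub_ne_zero hI u
      | coe t =>
        intro h
        simp only [cauchyKernel_coe] at h
        have h2 := sub_left_injective (inv_injective h)
        exact hxy (by rw [Complex.ofReal_injective h2])
  have htop := ContinuousMap.starSubalgebra_topologicalClosure_eq_top_of_separatesPoints A hsep
  rw [eq_top_iff]
  intro f _
  have hf : f ∈ A.topologicalClosure := by rw [htop]; trivial
  have hf' : f ∈ closure (A : Set C(Boundary, ℂ)) := hf
  exact closure_minimal hsub (Submodule.isClosed_topologicalClosure _) hf'

theorem dense_span_atomicFamily :
    Dense (Submodule.span ℂ atomicFamily : Set C(Boundary, ℂ)) := by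
  rw [Submodule.dense_iff_topologicalClosure_eq_top]
  exact topologicalClosure_span_atomicFamily

/-! ### Uniqueness of representing measures -/

theorem integrable_of_continuousMap (lam : Measure Boundary) [IsFiniteMeasure lam]
    (f : C(Boundary, ℂ)) : Integrable f lam :=
  f.continuous.integrable_of_hasCompactSupport (HasCompactSupport.of_compactSpace f)

/-- Integration against a finite measure, as a continuous linear functional. -/
noncomputable def integralCLM (lam : Measure Boundary) [IsFiniteMeasure lam] :
    C(Boundary, ℂ) →L[ℂ] ℂ :=
  LinearMap.mkContinuous
    { toFun := fun f => ∫ s, f s ∂lam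
      map_add' := fun f g => integral_add (integrable_of_continuousMap lam f)
        (integrable_of_continuousMap lam g)
      map_smul' := fun c f => integral_const_mul c f }
    (lam.real Set.univ) (fun f => by
      rw [mul_comm]
      exact norm_integral_le_of_norm_le_const (ae_of_all _ f.norm_coe_le_norm))

@[simp]
theorem integralCLM_apply (lam : Measure Boundary) [IsFiniteMeasure lam] (f : C(Boundary, ℂ)) :
    integralCLM lam f = ∫ s, f s ∂lam := rfl

theorem norm_integralCLM_apply_le (lam : Measure Boundary) [IsFiniteMeasure lam]
    (f : C(Boundary, ℂ)) : ‖integralCLM lam f‖ ≤ lam.real Set.univ * ‖f‖ := by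
  rw [mul_comm]
  exact norm_integral_le_of_norm_le_const (ae_of_all _ f.norm_coe_le_norm)

theorem integralCLM_star (lam : Measure Boundary) [IsFiniteMeasure lam] (f : C(Boundary, ℂ)) :
    integralCLM lam (star f) = star (integralCLM lam f) :=
  integral_conj

theorem integralCLM_one (lam : Measure Boundary) [IsFiniteMeasure lam] :
    integralCLM lam 1 = (lam.real Set.univ : ℂ) := by
  simp

/-- A Cauchy kernel is continuous and injective, so it embeds the compact boundary circle in the
metric space `ℂ`. -/
theorem metrizableSpace_boundary : TopologicalSpace.MetrizableSpace Boundary := by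
  have hI : Complex.I.im ≠ 0 := by simp
  have hinj : Function.Injective (cauchyKernel Complex.I hI) := by
    intro x y h
    induction x using OnePoint.rec with
    | infty =>
      induction y using OnePoint.rec with
      | infty => rfl
      | coe t => exact absurd h.symm (by simpa using ofReal_sub_ne_zero hI t)
    | coe u =>
      induction y using OnePoint.rec with
      | infty => exact absurd h (by simpa using ofReal_sub_ne_zero hI u)
      | coe t =>
        simp only [cauchyKernel_coe] at h
        rw [Complex.ofReal_injective (sub_left_injective (inv_injective h))]
  exact ((cauchyKernel Complex.I hI).continuous.isClosedEmbedding
    hinj).isEmbedding.metrizableSpace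

/-- A finite measure on the boundary circle is determined by its integrals of the atomic
endofunctions. -/
theorem measure_ext_of_integral_atomicMap (lam nu : Measure Boundary) [IsFiniteMeasure lam]
    [IsFiniteMeasure nu]
    (h : ∀ z : ℍ, integralCLM lam (atomicMap z) = integralCLM nu (atomicMap z)) :
    lam = nu := by
  have hL : integralCLM lam = integralCLM nu := by
    refine ContinuousLinearMap.ext_on dense_span_atomicFamily ?_
    rintro _ (⟨z, rfl⟩ | ⟨z, rfl⟩)
    · exact h z
    · simp only [integralCLM_star, h z]
  have := metrizableSpace_boundary
  let := TopologicalSpace.metrizableSpaceMetric Boundary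
  refine ext_of_forall_integral_eq_of_IsFiniteMeasure (fun f => ?_)
  have h1 := DFunLike.congr_fun hL
    (⟨fun s => ((f s : ℝ) : ℂ), Complex.continuous_ofReal.comp f.continuous⟩ : C(Boundary, ℂ))
  simp only [integralCLM_apply, ContinuousMap.coe_mk] at h1
  rw [integral_complex_ofReal, integral_complex_ofReal] at h1
  exact_mod_cast h1

/-- The constant in the representation need only be real: evaluation at `i`, where every atomic
endofunction takes the value `i`, identifies it as `Re φ(i)`. -/
theorem isRepresentingMeasure_of_eq_add (φ : ℍ → ℍ) (lam : Measure Boundary)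
    [IsFiniteMeasure lam] (c : ℝ) (h : ∀ z : ℍ, (φ z : ℂ) = c + integralCLM lam (atomicMap z)) :
    IsRepresentingMeasure φ lam := by
  refine ⟨inferInstance, fun z => ?_⟩
  have hI := congrArg Complex.re (h UpperHalfPlane.I)
  rw [atomicMap_I, map_smul, integralCLM_one] at hI
  have hc : (φ UpperHalfPlane.I).re = c := by
    change ((φ UpperHalfPlane.I : ℍ) : ℂ).re = c
    rw [hI]
    simp
  rw [hc, h z]
  simp only [integralCLM_apply, atomicMap_apply]

theorem IsRepresentingMeasure.integralCLM_atomicMap {φ : ℍ → ℍ} {lam : Measure Boundary}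
    [IsFiniteMeasure lam] (h : IsRepresentingMeasure φ lam) (z : ℍ) :
    integralCLM lam (atomicMap z) = (φ z : ℂ) - ((φ UpperHalfPlane.I).re : ℂ) := by
  rw [h.2 z, add_sub_cancel_left]
  simp only [integralCLM_apply, atomicMap_apply]

theorem IsRepresentingMeasure.unique {φ : ℍ → ℍ} {lam nu : Measure Boundary}
    (h : IsRepresentingMeasure φ lam) (h' : IsRepresentingMeasure φ nu) : lam = nu := by
  have := h.1
  have := h'.1
  exact measure_ext_of_integral_atomicMap lam nu
    (fun z => by rw [h.integralCLM_atomicMap, h'.integralCLM_atomicMap])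

/-- The total mass of a representing measure is `Im φ(i)`. -/
theorem IsRepresentingMeasure.measureReal_univ {φ : ℍ → ℍ} {lam : Measure Boundary}
    (h : IsRepresentingMeasure φ lam) : lam.real Set.univ = (φ UpperHalfPlane.I).im := by
  have := h.1
  have h1 := h.integralCLM_atomicMap UpperHalfPlane.I
  rw [atomicMap_I, map_smul, integralCLM_one] at h1
  have h2 := congrArg Complex.im h1
  simpa using h2

/-! ### The harmonic measure at `i` -/

/-- The image of `exp (i θ)` under the Cayley transform onto the boundary circle, that is
`tan (θ / 2)`, or `∞` at the odd multiples of `π`. -/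
noncomputable def circleParam (θ : ℝ) : Boundary :=
  if Real.cos (θ / 2) = 0 then OnePoint.infty else ((Real.tan (θ / 2) : ℝ) : Boundary)

theorem measurable_circleParam : Measurable circleParam := by
  refine Measurable.ite ?_ measurable_const ?_
  · exact measurableSet_eq_fun (by fun_prop) measurable_const
  · refine OnePoint.continuous_coe.measurable.comp ?_
    have : (fun θ : ℝ => Real.tan (θ / 2)) = fun θ => Real.sin (θ / 2) / Real.cos (θ / 2) := by
      funext θ
      exact Real.tan_eq_sin_div_cos _
    rw [this]
    fun_prop

/-- The harmonic measure of the upper half plane at `i`, the probability measure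
`dt / (π (1 + t²))`, as the image of normalised arc length under the Cayley transform. -/
noncomputable def harmonicMeasure : Measure Boundary :=
  ENNReal.ofReal (2 * Real.pi)⁻¹ •
    Measure.map circleParam (volume.restrict (Set.Ioc 0 (2 * Real.pi)))

instance : IsFiniteMeasure harmonicMeasure := by
  unfold harmonicMeasure
  have : IsFiniteMeasure (Measure.map circleParam (volume.restrict (Set.Ioc 0 (2 * Real.pi)))) :=
    Measure.isFiniteMeasure_map _ _
  exact Measure.smul_finite _ ENNReal.ofReal_ne_top

theorem integralCLM_harmonicMeasure (f : C(Boundary, ℂ)) (F : ℂ → ℂ)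
    (h : ∀ θ, f (circleParam θ) = F (circleMap 0 1 θ)) :
    integralCLM harmonicMeasure f = Real.circleAverage F 0 1 := by
  rw [integralCLM_apply, harmonicMeasure, integral_smul_measure,
    integral_map measurable_circleParam.aemeasurable f.continuous.aestronglyMeasurable,
    Real.circleAverage, intervalIntegral.integral_of_le (by positivity),
    ENNReal.toReal_ofReal (by positivity)]
  simp only [h]

theorem I_sub_sub_mul_ne_zero {w u : ℂ} (hw : w.im < 0) (hu : ‖u‖ ≤ 1) :
    Complex.I - w - (Complex.I + w) * u ≠ 0 := by
  intro h
  have h1 : Complex.I - w = (Complex.I + w) * u := sub_eq_zero.mp h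
  have h2 : ‖Complex.I - w‖ ≤ ‖Complex.I + w‖ := by
    rw [h1, norm_mul]
    exact mul_le_of_le_one_right (norm_nonneg _) hu
  have h3 := pow_le_pow_left₀ (norm_nonneg _) h2 2
  rw [← Complex.normSq_eq_norm_sq, ← Complex.normSq_eq_norm_sq, Complex.normSq_apply,
    Complex.normSq_apply] at h3
  simp at h3
  nlinarith

/-- In the circle coordinate `u`, the Cauchy kernel at `w` is a linear fractional function, with
its pole outside the closed unit disc when `w` lies in the lower half plane. -/
theorem cauchyKernel_circleParam {w : ℂ} (hw : w.im < 0) (θ : ℝ) :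
    cauchyKernel w hw.ne (circleParam θ)
      = (circleMap 0 1 θ + 1)
        / (Complex.I - w - (Complex.I + w) * circleMap 0 1 θ) := by
  set c : ℂ := (Real.cos (θ / 2) : ℂ) with hc
  set s : ℂ := (Real.sin (θ / 2) : ℂ) with hs
  have hcs : c ^ 2 + s ^ 2 = 1 := by
    rw [hc, hs]
    exact_mod_cast Real.cos_sq_add_sin_sq (θ / 2)
  -- With `v = c + i s` one has `u = v ^ 2`, `u + 1 = 2 c v` and `1 - u = -2 i s v`.
  have hu : circleMap 0 1 θ = (c + s * Complex.I) ^ 2 := by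
    have : c + s * Complex.I = Complex.exp ((θ / 2 : ℝ) * Complex.I) := by
      rw [Complex.exp_mul_I, hc, hs, Complex.ofReal_cos, Complex.ofReal_sin]
    rw [this, ← Complex.exp_nat_mul, circleMap]
    simp only [Complex.ofReal_one, zero_add, one_mul]
    congr 1
    push_cast
    ring
  have hD : Complex.I - w - (Complex.I + w) * circleMap 0 1 θ ≠ 0 :=
    I_sub_sub_mul_ne_zero hw (by simp)
  have hnum : circleMap 0 1 θ + 1 = 2 * c * (c + s * Complex.I) := by
    rw [hu]
    linear_combination (-1) * hcs + s ^ 2 * Complex.I_sq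
  have hden : Complex.I - w - (Complex.I + w) * circleMap 0 1 θ
      = 2 * (c + s * Complex.I) * (s - w * c) := by
    rw [hu]
    linear_combination (-Complex.I + w) * hcs
      - (2 * c * s + Complex.I * s ^ 2 + w * s ^ 2) * Complex.I_sq
  rw [hnum, hden]
  rw [hden] at hD
  have hv : c + s * Complex.I ≠ 0 := by
    intro h0
    simp [h0] at hD
  have hsw : s - w * c ≠ 0 := by
    intro h0
    simp [h0] at hD
  by_cases h0 : Real.cos (θ / 2) = 0
  · have hc0 : c = 0 := by rw [hc, h0, Complex.ofReal_zero]
    simp [circleParam, h0, hc0]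
  · have hc0 : c ≠ 0 := by rw [hc]; exact_mod_cast h0
    rw [circleParam, if_neg h0, cauchyKernel_coe, Real.tan_eq_sin_div_cos, Complex.ofReal_div,
      ← hs, ← hc]
    have h4 : s / c - w = (s - w * c) / c := by field_simp
    rw [h4, inv_div]
    field_simp

theorem diffContOnCl_circleKernel {w : ℂ} (hw : w.im < 0) :
    DiffContOnCl ℂ (fun u : ℂ => (u + 1) / (Complex.I - w - (Complex.I + w) * u))
      (Metric.ball 0 |1|) := by
  refine DifferentiableOn.diffContOnCl ?_
  rw [abs_one, closure_ball _ one_ne_zero]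
  refine DifferentiableOn.div (by fun_prop) (by fun_prop) (fun u hu => ?_)
  exact I_sub_sub_mul_ne_zero hw (by simpa using hu)

/-- The mean value property at `i` for the Cauchy kernel at a point of the lower half plane. -/
theorem integralCLM_harmonicMeasure_cauchyKernel {w : ℂ} (hw : w.im < 0) :
    integralCLM harmonicMeasure (cauchyKernel w hw.ne) = (Complex.I - w)⁻¹ := by
  rw [integralCLM_harmonicMeasure _
    (fun u => (u + 1) / (Complex.I - w - (Complex.I + w) * u)) (cauchyKernel_circleParam hw),
    (diffContOnCl_circleKernel hw).circleAverage]
  simp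

/-- Products of functions holomorphic in the upper half plane are holomorphic, so the mean value
property at `i` is multiplicative on them. -/
theorem integralCLM_harmonicMeasure_cauchyKernel_mul {w v : ℂ} (hw : w.im < 0) (hv : v.im < 0) :
    integralCLM harmonicMeasure (cauchyKernel w hw.ne * cauchyKernel v hv.ne)
      = (Complex.I - w)⁻¹ * (Complex.I - v)⁻¹ := by
  rw [integralCLM_harmonicMeasure _
    (fun u => (u + 1) / (Complex.I - w - (Complex.I + w) * u)
      * ((u + 1) / (Complex.I - v - (Complex.I + v) * u)))
    (fun θ => by
      rw [ContinuousMap.mul_apply, cauchyKernel_circleParam hw, cauchyKernel_circleParam hv])]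
  have h := (diffContOnCl_circleKernel hw).smul (diffContOnCl_circleKernel hv)
  simp only [smul_eq_mul] at h
  rw [h.circleAverage]
  simp

theorem integralCLM_harmonicMeasure_one : integralCLM harmonicMeasure 1 = 1 := by
  rw [integralCLM_harmonicMeasure 1 (fun _ => 1) (fun _ => rfl), Real.circleAverage_const]

theorem integralCLM_harmonicMeasure_cauchyKernel_of_pos {w : ℂ} (hw : 0 < w.im) :
    integralCLM harmonicMeasure (cauchyKernel w hw.ne') = (-Complex.I - w)⁻¹ := by
  have hw' : (star w).im < 0 := by simpa using hw
  have h := congrArg star (integralCLM_harmonicMeasure_cauchyKernel hw')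
  rw [← integralCLM_star, star_cauchyKernel] at h
  simpa using h

theorem integralCLM_harmonicMeasure_cauchyKernel_mul_of_pos {w v : ℂ} (hw : 0 < w.im)
    (hv : 0 < v.im) :
    integralCLM harmonicMeasure (cauchyKernel w hw.ne' * cauchyKernel v hv.ne')
      = (-Complex.I - w)⁻¹ * (-Complex.I - v)⁻¹ := by
  have hw' : (star w).im < 0 := by simpa using hw
  have hv' : (star v).im < 0 := by simpa using hv
  have h := congrArg star (integralCLM_harmonicMeasure_cauchyKernel_mul hw' hv')
  rw [← integralCLM_star, star_mul', star_cauchyKernel, star_cauchyKernel] at h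
  simpa using h

theorem neg_I_sub_ne_zero {w : ℂ} (hw : 0 < w.im) : -Complex.I - w ≠ 0 := by
  intro h
  have := congrArg Complex.im h
  simp at this
  linarith

theorem inv_neg_I_sub_mul {w : ℂ} (hw : 0 < w.im) :
    (-Complex.I - w)⁻¹ * (1 + w ^ 2) = Complex.I - w := by
  have h := neg_I_sub_ne_zero hw
  field_simp
  linear_combination Complex.I_sq

theorem integralCLM_harmonicMeasure_atomicMap (z : ℍ) :
    integralCLM harmonicMeasure (atomicMap z) = Complex.I := by
  rw [atomicMap, map_add, map_smul, map_smul, integralCLM_harmonicMeasure_one,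
    integralCLM_harmonicMeasure_cauchyKernel_of_pos z.im_pos, smul_eq_mul, smul_eq_mul]
  linear_combination inv_neg_I_sub_mul z.im_pos

/-! ### Existence when the pole lies on the boundary circle -/

/-- An affine map of the upper half plane into itself has real nonnegative slope and a constant
term with nonnegative imaginary part. -/
theorem affine_coeff_of_im_pos {A B : ℂ} (h : ∀ w : ℂ, 0 < w.im → 0 < (A + B * w).im) :
    B.im = 0 ∧ 0 ≤ B.re ∧ 0 ≤ A.im := by
  have h' : ∀ x y : ℝ, 0 < y → 0 < A.im + (B.re * y + B.im * x) := by
    intro x y hy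
    simpa using h ⟨x, y⟩ hy
  have h1 : B.im = 0 := by
    by_contra h0
    have := h' (-(A.im + B.re) / B.im) 1 one_pos
    rw [mul_div_cancel₀ _ h0] at this
    linarith
  simp only [h1, zero_mul, add_zero] at h'
  have h2 : 0 ≤ B.re := by
    by_contra! h0
    have hy : 0 < (|A.im| + 1) / (-B.re) := div_pos (by positivity) (by linarith)
    have := h' 0 _ hy
    have e : B.re * ((|A.im| + 1) / (-B.re)) = -(|A.im| + 1) := by
      have := h0.ne
      field_simp
    rw [e] at this
    linarith [le_abs_self A.im]
  refine ⟨h1, h2, ?_⟩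
  by_contra! h0
  have hy : 0 < (-A.im) / (B.re + 1) := div_pos (by linarith) (by linarith)
  have := h' 0 _ hy
  have e : A.im + B.re * ((-A.im) / (B.re + 1)) = A.im / (B.re + 1) := by
    field_simp
    ring
  rw [e] at this
  exact absurd (div_neg_of_neg_of_pos h0 (by linarith : 0 < B.re + 1)) (not_lt.mpr this.le)

/-- The atomic endofunctions are surjective on the upper half plane. -/
theorem exists_atomic_eq (s : Boundary) {w : ℂ} (hw : 0 < w.im) : ∃ z : ℍ, atomic s z = w := by
  induction s using OnePoint.rec with
  | infty => exact ⟨⟨w, hw⟩, rfl⟩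
  | coe t =>
    have h0 : (t : ℂ) + w ≠ 0 := by
      intro h
      have := congrArg Complex.im h
      simp at this
      linarith
    have him : 0 < ((w * t - 1) / (t + w)).im := by
      rw [Complex.div_im, ← sub_div]
      refine div_pos ?_ (Complex.normSq_pos.mpr h0)
      simp
      nlinarith [mul_nonneg hw.le (sq_nonneg t)]
    refine ⟨⟨_, him⟩, ?_⟩
    change (1 + (t : ℂ) * ((w * t - 1) / (t + w))) / ((t : ℂ) - (w * t - 1) / (t + w)) = w
    have h1 : (1 + (t : ℂ) ^ 2) ≠ 0 := by
      have : (0 : ℝ) < 1 + t ^ 2 := by positivity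
      exact_mod_cast this.ne'
    have e1 : 1 + (t : ℂ) * ((w * t - 1) / (t + w)) = w * (1 + (t : ℂ) ^ 2) / (t + w) := by
      field_simp
      ring
    have e2 : (t : ℂ) - (w * t - 1) / (t + w) = (1 + (t : ℂ) ^ 2) / (t + w) := by
      field_simp
      ring
    rw [e1, e2]
    field_simp

/-- An endofunction that is affine in an atomic endofunction is represented by a multiple of the
harmonic measure plus a point mass. -/
theorem exists_isRepresentingMeasure_of_affine_atomic (φ : ℍ → ℍ) (s : Boundary) (A B : ℂ)
    (h : ∀ z : ℍ, (φ z : ℂ) = A + B * atomic s z) : ∃ lam, IsRepresentingMeasure φ lam := by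
  obtain ⟨h1, h2, h3⟩ : B.im = 0 ∧ 0 ≤ B.re ∧ 0 ≤ A.im := by
    refine affine_coeff_of_im_pos (fun w hw => ?_)
    obtain ⟨z, rfl⟩ := exists_atomic_eq s hw
    rw [← h z]
    exact (φ z).im_pos
  have : IsFiniteMeasure (ENNReal.ofReal A.im • harmonicMeasure) :=
    Measure.smul_finite _ ENNReal.ofReal_ne_top
  have : IsFiniteMeasure (ENNReal.ofReal B.re • Measure.dirac s) :=
    Measure.smul_finite _ ENNReal.ofReal_ne_top
  refine ⟨ENNReal.ofReal A.im • harmonicMeasure + ENNReal.ofReal B.re • Measure.dirac s,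
    isRepresentingMeasure_of_eq_add φ _ A.re (fun z => ?_)⟩
  have hω : ∫ t, atomicMap z t ∂harmonicMeasure = Complex.I :=
    integralCLM_harmonicMeasure_atomicMap z
  rw [integralCLM_apply, integral_add_measure (integrable_of_continuousMap _ _)
    (integrable_of_continuousMap _ _), integral_smul_measure, integral_smul_measure,
    integral_dirac, hω, ENNReal.toReal_ofReal h3, ENNReal.toReal_ofReal h2, atomicMap_apply, h z,
    ← add_assoc, Complex.real_smul, Complex.real_smul, Complex.re_add_im]
  congr 2
  exact Complex.ext (by simp) (by simp [h1])

/-! ### Existence when the pole lies in the lower half plane -/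

/-- The boundary values `s ↦ α + β / (p - s)` of a linear fractional function with pole `p` in
the lower half plane. -/
noncomputable def boundaryValue {p : ℂ} (hp : p.im < 0) (α β : ℂ) : C(Boundary, ℂ) :=
  α • (1 : C(Boundary, ℂ)) - β • cauchyKernel p hp.ne

/-- The boundary values extend holomorphically to the upper half plane, so the value of the
integral is made up of the residues there, at `i` and at the pole `z` of `s ↦ φ_s(z)`. -/
theorem integralCLM_harmonicMeasure_atomicMap_mul {p : ℂ} (hp : p.im < 0) (α β : ℂ)
    (z : ℍ) :
    integralCLM harmonicMeasure (atomicMap z * boundaryValue hp α β)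
      = 2 * Complex.I * (α + β / (p - z)) - Complex.I * (α + β / (p - Complex.I)) := by
  have hz := z.im_pos
  have hzp : (z : ℂ) ≠ p := by
    intro h
    rw [← h] at hp
    exact absurd hz (not_lt.mpr hp.le)
  have e : atomicMap z * boundaryValue hp α β
      = ((z : ℂ) * α) • (1 : C(Boundary, ℂ))
        + ((1 + (z : ℂ) ^ 2) * α) • cauchyKernel z (im_ne_zero z)
        - ((z : ℂ) * β) • cauchyKernel p hp.ne
        - ((1 + (z : ℂ) ^ 2) * β * (z - p)⁻¹) •
          (cauchyKernel z (im_ne_zero z) - cauchyKernel p hp.ne) := by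
    rw [mul_smul _ ((z : ℂ) - p)⁻¹, ← cauchyKernel_mul _ _ _ _ hzp]
    ext s
    simp [atomicMap, boundaryValue]
    ring
  rw [e]
  simp only [map_add, map_sub, map_smul, integralCLM_harmonicMeasure_one,
    integralCLM_harmonicMeasure_cauchyKernel hp,
    integralCLM_harmonicMeasure_cauchyKernel_of_pos hz, smul_eq_mul]
  have h2 : Complex.I - p ≠ 0 := by
    intro h
    have := congrArg Complex.im h
    simp at this
    linarith
  have h3 : (z : ℂ) - p ≠ 0 := sub_ne_zero.mpr hzp
  have e1 := inv_neg_I_sub_mul hz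
  have e2 : (p - (z : ℂ)) = -((z : ℂ) - p) := by ring
  have e3 : (p - Complex.I) = -(Complex.I - p) := by ring
  rw [e2, e3]
  have e4 : (1 + (z : ℂ) ^ 2) * β * ((z : ℂ) - p)⁻¹
        * ((-Complex.I - (z : ℂ))⁻¹ - (Complex.I - p)⁻¹)
      = β * ((z : ℂ) - p)⁻¹ * ((Complex.I - z) - (1 + (z : ℂ) ^ 2) * (Complex.I - p)⁻¹) := by
    linear_combination (β * ((z : ℂ) - p)⁻¹) * e1
  rw [e4]
  have e5 : (1 + (z : ℂ) ^ 2) * α * (-Complex.I - (z : ℂ))⁻¹ = α * (Complex.I - z) := by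
    linear_combination α * e1
  rw [e5]
  field_simp
  linear_combination β * Complex.I_sq

/-- Both factors extend holomorphically to the lower half plane, so the integral is the value of
the product at `-i`. -/
theorem integralCLM_harmonicMeasure_atomicMap_mul_star {p : ℂ} (hp : p.im < 0) (α β : ℂ)
    (z : ℍ) :
    integralCLM harmonicMeasure (atomicMap z * star (boundaryValue hp α β))
      = Complex.I * star (α + β / (p - Complex.I)) := by
  have hz := z.im_pos
  have hq : 0 < (star p).im := by simpa using hp
  have e : atomicMap z * star (boundaryValue hp α β)
      = ((z : ℂ) * star α) • (1 : C(Boundary, ℂ))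
        + ((1 + (z : ℂ) ^ 2) * star α) • cauchyKernel z (im_ne_zero z)
        - ((z : ℂ) * star β) • cauchyKernel (star p) hq.ne'
        - ((1 + (z : ℂ) ^ 2) * star β) •
          (cauchyKernel z (im_ne_zero z) * cauchyKernel (star p) hq.ne') := by
    rw [← star_cauchyKernel p hp.ne]
    ext s
    simp [atomicMap, boundaryValue]
    ring
  rw [e]
  simp only [map_add, map_sub, map_smul, integralCLM_harmonicMeasure_one,
    integralCLM_harmonicMeasure_cauchyKernel_of_pos hq,
    integralCLM_harmonicMeasure_cauchyKernel_mul_of_pos hz hq,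
    integralCLM_harmonicMeasure_cauchyKernel_of_pos hz, smul_eq_mul]
  have e0 : star (α + β / (p - Complex.I)) = star α - star β * (-Complex.I - star p)⁻¹ := by
    rw [star_add, star_div₀, star_sub]
    have : star Complex.I = -Complex.I := Complex.conj_I
    rw [this, show star p - -Complex.I = -(-Complex.I - star p) by ring, div_neg,
      div_eq_mul_inv, ← sub_eq_add_neg]
  have e1 := inv_neg_I_sub_mul hz
  rw [e0]
  linear_combination (star α - star β * (-Complex.I - star p)⁻¹) * e1

theorem boundaryValue_im_nonneg {p : ℂ} (hp : p.im < 0) (α β : ℂ)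
    (h : ∀ z : ℍ, 0 ≤ (α + β / (p - z)).im) (s : Boundary) :
    0 ≤ (boundaryValue hp α β s).im := by
  have hcl : IsClosed {s : Boundary | 0 ≤ (boundaryValue hp α β s).im} :=
    isClosed_le continuous_const (Complex.continuous_im.comp (boundaryValue hp α β).continuous)
  refine OnePoint.denseRange_coe.induction_on (p := fun s => 0 ≤ (boundaryValue hp α β s).im) s
    hcl (fun t => ?_)
  have hne : p - ((t : ℂ) + (0 : ℝ) * Complex.I) ≠ 0 := by
    have := ofReal_sub_ne_zero hp.ne t
    intro h0
    apply this
    rw [← neg_eq_zero, ← h0]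
    push_cast
    ring
  have hcont : ContinuousAt
      (fun ε : ℝ => (α + β / (p - ((t : ℂ) + ε * Complex.I))).im) 0 := by
    refine Complex.continuous_im.continuousAt.comp ?_
    refine continuousAt_const.add (continuousAt_const.div ?_ hne)
    fun_prop
  have hlim : Tendsto (fun ε : ℝ => (α + β / (p - ((t : ℂ) + ε * Complex.I))).im) (𝓝[>] 0)
      (𝓝 (α + β / (p - ((t : ℂ) + (0 : ℝ) * Complex.I))).im) :=
    hcont.tendsto.mono_left nhdsWithin_le_nhds
  have hval : boundaryValue hp α β (t : Boundary)
      = α + β / (p - ((t : ℂ) + (0 : ℝ) * Complex.I)) := by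
    have e : p - ((t : ℂ) + (0 : ℝ) * Complex.I) = -((t : ℂ) - p) := by
      push_cast
      ring
    rw [e, div_neg]
    simp [boundaryValue, div_eq_mul_inv, sub_eq_add_neg]
  rw [hval]
  refine ge_of_tendsto hlim ?_
  filter_upwards [self_mem_nhdsWithin] with ε hε
  have hε' : 0 < ((t : ℂ) + ε * Complex.I).im := by simpa using hε
  exact h ⟨_, hε'⟩

/-- An endofunction `α + β / (p - z)` is represented by the harmonic measure weighted with the
imaginary part of the boundary values. -/
theorem exists_isRepresentingMeasure_of_lower_pole {p : ℂ} (hp : p.im < 0) (α β : ℂ)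
    (φ : ℍ → ℍ)
    (h : ∀ z : ℍ, (φ z : ℂ) = α + β / (p - z)) : ∃ lam, IsRepresentingMeasure φ lam := by
  set Φ := boundaryValue hp α β with hΦ
  have hnn : ∀ s, 0 ≤ (Φ s).im := boundaryValue_im_nonneg hp α β (fun z => by
    rw [← h z]
    exact (φ z).im_pos.le)
  have hcont : Continuous (fun s => (Φ s).im) := Complex.continuous_im.comp Φ.continuous
  have hint : Integrable (fun s => (Φ s).im) harmonicMeasure :=
    hcont.integrable_of_hasCompactSupport (HasCompactSupport.of_compactSpace _)
  have hfin : IsFiniteMeasure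
      (harmonicMeasure.withDensity (fun s => ENNReal.ofReal (Φ s).im)) :=
    isFiniteMeasure_withDensity_ofReal hint.2
  refine ⟨_, isRepresentingMeasure_of_eq_add φ
    (harmonicMeasure.withDensity (fun s => ENNReal.ofReal (Φ s).im))
    (α + β / (p - Complex.I)).re (fun z => ?_)⟩
  have e1 : integralCLM (harmonicMeasure.withDensity (fun s => ENNReal.ofReal (Φ s).im))
      (atomicMap z)
      = integralCLM harmonicMeasure
        ((2 * Complex.I)⁻¹ • (atomicMap z * Φ - atomicMap z * star Φ)) := by
    rw [integralCLM_apply, integral_withDensity_eq_integral_toReal_smul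
      hcont.measurable.ennreal_ofReal (ae_of_all _ fun _ => ENNReal.ofReal_lt_top),
      integralCLM_apply]
    refine integral_congr_ae (ae_of_all _ fun s => ?_)
    have him : ((Φ s).im : ℂ) = (2 * Complex.I)⁻¹ * (Φ s - star (Φ s)) := by
      rw [Complex.im_eq_sub_conj, div_eq_inv_mul]
      rfl
    simp only [ENNReal.toReal_ofReal (hnn s), Complex.real_smul, him]
    simp only [ContinuousMap.smul_apply, ContinuousMap.sub_apply, ContinuousMap.mul_apply,
      ContinuousMap.star_apply, smul_eq_mul]
    ring
  have hre : ((α + β / (p - Complex.I)).re : ℂ)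
      = ((α + β / (p - Complex.I)) + star (α + β / (p - Complex.I))) / 2 :=
    Complex.re_eq_add_conj _
  rw [h z, e1, map_smul, map_sub, hΦ, integralCLM_harmonicMeasure_atomicMap_mul,
    integralCLM_harmonicMeasure_atomicMap_mul_star, hre, smul_eq_mul]
  have hI : (2 * Complex.I)⁻¹ * Complex.I = 1 / 2 := by
    have := Complex.I_ne_zero
    field_simp
  linear_combination
    (-2 * (α + β / (p - z)) + (α + β / (p - Complex.I)) + star (α + β / (p - Complex.I))) * hI

/-! ### Representing measures of linear fractional endofunctions -/

theorem linear_div_linear_eq (a b : ℂ) {c d w : ℂ} (hc : c ≠ 0) (hw : c * w + d ≠ 0) :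
    (a * w + b) / (c * w + d) = a / c + ((a * d - b * c) / c ^ 2) / (-d / c - w) := by
  have h : -d / c - w = -((c * w + d) / c) := by
    field_simp
    ring
  rw [h, div_neg, div_div_eq_mul_div, ← sub_eq_add_neg, div_eq_iff hw, sub_mul,
    div_mul_cancel₀ _ hw]
  field_simp
  ring

theorem exists_isRepresentingMeasure_endoFun (M : Endomatrices) :
    ∃ lam, IsRepresentingMeasure (endoFun M) lam := by
  set a := (M : GL (Fin 2) ℂ) 0 0 with ha
  set b := (M : GL (Fin 2) ℂ) 0 1 with hb
  set c := (M : GL (Fin 2) ℂ) 1 0 with hc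
  set d := (M : GL (Fin 2) ℂ) 1 1 with hd
  have hval : ∀ z : ℍ, (endoFun M z : ℂ) = (a * z + b) / (c * z + d) := fun z => rfl
  have hne : ∀ z : ℂ, 0 < z.im → c * z + d ≠ 0 := fun z hz => (M.2 z hz).1
  by_cases h0 : c = 0
  · refine exists_isRepresentingMeasure_of_affine_atomic _ OnePoint.infty (b / d) (a / d)
      (fun z => ?_)
    change _ = b / d + a / d * (z : ℂ)
    rw [hval, h0]
    ring
  · have hpole : c * (-d / c) + d = 0 := by
      field_simp
      ring
    have hp : (-d / c).im ≤ 0 := by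
      by_contra! hpos
      exact hne _ hpos hpole
    have hform : ∀ z : ℍ, (endoFun M z : ℂ)
        = a / c + ((a * d - b * c) / c ^ 2) / (-d / c - z) := by
      intro z
      rw [hval]
      exact linear_div_linear_eq a b h0 (hne z z.im_pos)
    rcases hp.lt_or_eq with hlt | heq
    · exact exists_isRepresentingMeasure_of_lower_pole hlt _ _ _ hform
    · set t : ℝ := (-d / c).re with ht
      have htp : -d / c = (t : ℂ) := Complex.ext (by simp [ht]) (by simp [heq])
      -- `φ_t(z) = -t + (1 + t²) / (t - z)` is affine in `1 / (t - z)`.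
      refine exists_isRepresentingMeasure_of_affine_atomic _ (t : Boundary)
        (a / c + ((a * d - b * c) / c ^ 2) * t / (1 + (t : ℂ) ^ 2))
        (((a * d - b * c) / c ^ 2) / (1 + (t : ℂ) ^ 2)) (fun z => ?_)
      rw [hform z, htp]
      change _ = _ + _ * ((1 + (t : ℂ) * z) / ((t : ℂ) - z))
      generalize (a * d - b * c) / c ^ 2 = γ
      have h1 := ofReal_sub_ne_zero (im_ne_zero z) t
      have h2 : (1 + (t : ℂ) ^ 2) ≠ 0 := by
        have : (0 : ℝ) < 1 + t ^ 2 := by positivity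
        exact_mod_cast this.ne'
      field_simp
      ring

theorem isRepresentingMeasure_mu (M : Endomatrices) :
    IsRepresentingMeasure (endoFun M) (mu M) := by
  have h := exists_isRepresentingMeasure_endoFun M
  rw [mu, representingMeasure, dif_pos h]
  exact h.choose_spec

theorem isRepresentingMeasure_iff_eq_mu (M : Endomatrices) (lam : Measure Boundary) :
    IsRepresentingMeasure (endoFun M) lam ↔ lam = mu M :=
  ⟨fun h => h.unique (isRepresentingMeasure_mu M), fun h => h ▸ isRepresentingMeasure_mu M⟩

instance (M : Endomatrices) : IsFiniteMeasure (mu M) := (isRepresentingMeasure_mu M).1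

/-! ### The operators `Λ_M` -/

theorem endoFun_mul (M N : Endomatrices) (z : ℍ) :
    endoFun (M * N) z = endoFun M (endoFun N z) :=
  UpperHalfPlane.ext (mobius_mul (M : GL (Fin 2) ℂ) N z (N.2 z z.im_pos).1).2

theorem endoFun_atomicMatrix (s : Boundary) (z : ℍ) :
    (endoFun (atomicMatrix s) z : ℂ) = atomic s z := by
  induction s using OnePoint.rec with
  | infty =>
    change mobius (1 : GL (Fin 2) ℂ) z = (z : ℂ)
    simp [mobius]
  | coe t =>
    change mobius (rotation t) z = (1 + (t : ℂ) * z) / ((t : ℂ) - z)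
    have hk : (((Real.sqrt (1 + t ^ 2))⁻¹ : ℝ) : ℂ) ≠ 0 := by
      have h : (0 : ℝ) < 1 + t ^ 2 := by positivity
      exact_mod_cast (inv_pos.mpr (Real.sqrt_pos.mpr h)).ne'
    rw [mobius, rotation_coe, ← mul_div_mul_left (1 + (t : ℂ) * z) ((t : ℂ) - z) hk]
    simp only [Matrix.smul_apply, Matrix.of_apply, Matrix.cons_val', Matrix.cons_val_zero,
      Matrix.cons_val_one, Matrix.cons_val_fin_one, smul_eq_mul]
    congr 1 <;> ring

theorem endoFun_leftTranslate (s : Boundary) (M : Endomatrices) (z : ℍ) :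
    (endoFun (leftTranslate s M) z : ℂ) = atomicMap (endoFun M z) s := by
  rw [leftTranslate, endoFun_mul, endoFun_atomicMatrix, atomicMap_apply]

/-- The real part of a continuous function, as a complex-valued function. -/
noncomputable def rePart (f : C(Boundary, ℂ)) : C(Boundary, ℂ) :=
  (2 : ℂ)⁻¹ • (f + star f)

theorem rePart_apply (f : C(Boundary, ℂ)) (s : Boundary) : rePart f s = ((f s).re : ℂ) := by
  rw [Complex.re_eq_add_conj, div_eq_inv_mul]
  rfl

/-- The value of `Λ_M` at the function `s ↦ φ_s(z)`: the translates of `φ_M` compose `φ_M` with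
the atomic endofunctions. -/
theorem integralCLM_mu_leftTranslate_atomicMap (M : Endomatrices) (s : Boundary) (z : ℍ) :
    integralCLM (mu (leftTranslate s M)) (atomicMap z)
      = (atomicMap (endoFun M z) - rePart (atomicMap (endoFun M UpperHalfPlane.I))) s := by
  rw [(isRepresentingMeasure_mu (leftTranslate s M)).integralCLM_atomicMap,
    ContinuousMap.sub_apply, rePart_apply, endoFun_leftTranslate, ← endoFun_leftTranslate s M
    UpperHalfPlane.I]
  rfl

/-- The masses `Im φ_s(φ_M(i))` of the measures `μ_{ₛM}` are bounded, being continuous in `s`. -/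
theorem measureReal_mu_leftTranslate_le (M : Endomatrices) (s : Boundary) :
    (mu (leftTranslate s M)).real Set.univ ≤ ‖atomicMap (endoFun M UpperHalfPlane.I)‖ := by
  rw [(isRepresentingMeasure_mu (leftTranslate s M)).measureReal_univ]
  have h : (endoFun (leftTranslate s M) UpperHalfPlane.I).im
      = (atomicMap (endoFun M UpperHalfPlane.I) s).im := by
    rw [← endoFun_leftTranslate]
    rfl
  rw [h]
  exact (le_abs_self _).trans ((Complex.abs_im_le_norm _).trans
    (ContinuousMap.norm_coe_le_norm _ s))

/-- Continuity in `s` is explicit for `f = φ_·(z)`; the uniform bound on the masses carries it to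
the closed span of these functions and their conjugates. -/
theorem continuous_integralCLM_mu_leftTranslate (M : Endomatrices) (f : C(Boundary, ℂ)) :
    Continuous (fun s => integralCLM (mu (leftTranslate s M)) f) := by
  have hspan : ∀ g ∈ Submodule.span ℂ atomicFamily,
      Continuous (fun s => integralCLM (mu (leftTranslate s M)) g) := by
    intro g hg
    induction hg using Submodule.span_induction with
    | mem g hg =>
      have hatom : ∀ z, Continuous (fun s => integralCLM (mu (leftTranslate s M)) (atomicMap z)) :=
        fun z => by
          simp only [integralCLM_mu_leftTranslate_atomicMap]
          exact ContinuousMap.continuous _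
      rcases hg with ⟨z, rfl⟩ | ⟨z, rfl⟩
      · exact hatom z
      · simp only [integralCLM_star]
        exact continuous_star.comp (hatom z)
    | zero => simpa only [map_zero] using continuous_const
    | add g g' _ _ h1 h2 =>
      simp only [map_add]
      exact h1.add h2
    | smul c g _ h1 =>
      simp only [map_smul]
      exact h1.const_smul c
  set C := ‖atomicMap (endoFun M UpperHalfPlane.I)‖ with hC
  refine continuous_of_uniform_approx_of_continuous (fun u hu => ?_)
  obtain ⟨ε, hε, hεu⟩ := Metric.mem_uniformity_dist.mp hu
  have hδ : 0 < ε / (C + 1) := by positivity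
  obtain ⟨g, hg, hfg⟩ := Metric.mem_closure_iff.mp (dense_span_atomicFamily f) _ hδ
  refine ⟨_, hspan g hg, fun s => hεu ?_⟩
  rw [dist_eq_norm, ← map_sub]
  rw [dist_eq_norm] at hfg
  calc ‖integralCLM (mu (leftTranslate s M)) (f - g)‖
      ≤ C * ‖f - g‖ := (norm_integralCLM_apply_le _ _).trans
        (mul_le_mul_of_nonneg_right (measureReal_mu_leftTranslate_le M s) (norm_nonneg _))
    _ ≤ (C + 1) * ‖f - g‖ := by
        gcongr
        linarith
    _ < (C + 1) * (ε / (C + 1)) := by gcongr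
    _ = ε := mul_div_cancel₀ _ (by positivity : 0 < C + 1).ne'

/-- The operator `Λ_M` with `(Λ_M f)(s) = μ_{ₛM}(f)`. -/
noncomputable def boundaryOperator (M : Endomatrices) :
    C(Boundary, ℂ) →L[ℂ] C(Boundary, ℂ) :=
  LinearMap.mkContinuous
    { toFun := fun f => ⟨fun s => integralCLM (mu (leftTranslate s M)) f,
        continuous_integralCLM_mu_leftTranslate M f⟩
      map_add' := fun f g => by
        ext s
        exact map_add (integralCLM (mu (leftTranslate s M))) f g
      map_smul' := fun c f => by
        ext s
        exact map_smul (integralCLM (mu (leftTranslate s M))) c f }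
    ‖atomicMap (endoFun M UpperHalfPlane.I)‖ (fun f => by
      rw [ContinuousMap.norm_le _ (by positivity)]
      intro s
      exact (norm_integralCLM_apply_le _ _).trans
        (mul_le_mul_of_nonneg_right (measureReal_mu_leftTranslate_le M s) (norm_nonneg _)))

theorem boundaryOperator_apply (M : Endomatrices) (f : C(Boundary, ℂ)) (s : Boundary) :
    boundaryOperator M f s = integralCLM (mu (leftTranslate s M)) f := rfl

theorem boundaryOperator_star (M : Endomatrices) (f : C(Boundary, ℂ)) :
    boundaryOperator M (star f) = star (boundaryOperator M f) := by
  ext s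
  exact integralCLM_star _ f

theorem boundaryOperator_rePart (M : Endomatrices) (f : C(Boundary, ℂ)) :
    boundaryOperator M (rePart f) = rePart (boundaryOperator M f) := by
  rw [rePart, map_smul, map_add, boundaryOperator_star, rePart]

theorem boundaryOperator_atomicMap (M : Endomatrices) (z : ℍ) :
    boundaryOperator M (atomicMap z)
      = atomicMap (endoFun M z) - rePart (atomicMap (endoFun M UpperHalfPlane.I)) := by
  ext s
  exact integralCLM_mu_leftTranslate_atomicMap M s z

theorem boundaryOperator_mul (M N : Endomatrices) :
    boundaryOperator (M * N) = (boundaryOperator M).comp (boundaryOperator N) := by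
  have hatom : ∀ z, boundaryOperator (M * N) (atomicMap z)
      = boundaryOperator M (boundaryOperator N (atomicMap z)) := by
    intro z
    rw [boundaryOperator_atomicMap N, map_sub, boundaryOperator_rePart]
    simp only [boundaryOperator_atomicMap, endoFun_mul]
    ext s
    simp only [ContinuousMap.sub_apply, rePart_apply, Complex.sub_re, Complex.ofReal_re]
    push_cast
    ring
  refine ContinuousLinearMap.ext_on dense_span_atomicFamily ?_
  rintro _ (⟨z, rfl⟩ | ⟨z, rfl⟩)
  · exact hatom z
  · simp only [ContinuousLinearMap.comp_apply, boundaryOperator_star, hatom z]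

theorem boundaryOperator_nonneg (M : Endomatrices) (f : C(Boundary, ℂ)) (hf : ∀ s, 0 ≤ f s)
    (s : Boundary) : 0 ≤ boundaryOperator M f s := by
  have hre : ∀ t, f t = ((f t).re : ℂ) := fun t => (Complex.eq_re_of_ofReal_le (hf t))
  have h : boundaryOperator M f s = ((∫ t, (f t).re ∂(mu (leftTranslate s M)) : ℝ) : ℂ) := by
    rw [boundaryOperator_apply, integralCLM_apply, ← integral_complex_ofReal]
    exact integral_congr_ae (ae_of_all _ hre)
  rw [h, Complex.zero_le_real]
  exact integral_nonneg (fun t => (Complex.nonneg_iff.mp (hf t)).1)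

end MobiusEndo

theorem mainTheorem2 :
    -- every `φ_M` has exactly one representing measure, namely `μ_M`
    (∀ M : MobiusEndo.Endomatrices, ∀ lam : Measure MobiusEndo.Boundary,
      MobiusEndo.IsRepresentingMeasure (MobiusEndo.endoFun M) lam ↔ lam = MobiusEndo.mu M) ∧
    -- the operators `(Λ_M f)(s) = μ_{ₛM}(f)` on `C(ℝ ∪ {∞})`
    ∃ Λ : MobiusEndo.Endomatrices →
        (C(MobiusEndo.Boundary, ℂ) →L[ℂ] C(MobiusEndo.Boundary, ℂ)),
      (∀ (M : MobiusEndo.Endomatrices) (f : C(MobiusEndo.Boundary, ℂ)) (s : MobiusEndo.Boundary),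
        Λ M f s = ∫ t, f t ∂(MobiusEndo.mu (MobiusEndo.leftTranslate s M))) ∧
      (∀ (M : MobiusEndo.Endomatrices) (f : C(MobiusEndo.Boundary, ℂ)),
        (∀ s, 0 ≤ f s) → ∀ s, 0 ≤ Λ M f s) ∧
      ∀ M N : MobiusEndo.Endomatrices, Λ (M * N) = (Λ M).comp (Λ N) :=
  ⟨MobiusEndo.isRepresentingMeasure_iff_eq_mu, MobiusEndo.boundaryOperator,
    fun _ _ _ => rfl, MobiusEndo.boundaryOperator_nonneg, MobiusEndo.boundaryOperator_mul⟩
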